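/- A pair of dual spaces $(E,F)$ over a division ring $\mathbb K$ consists of a left $\mathbb K$-vector space $E$, a right $\mathbb K$-vector space $F$ and a non-degenerate bilinear map $\beta:E\times F\to\mathbb K$. For $A\subseteq E$ put $A^\perp=\{y\in F:\beta(x,y)=0\ \forall x\in A\}$, for $B\subseteq F$ put $B^\perp=\{x\in E:\beta(x,y)=0\ \forall y\in B\}$, and let $\mathcal L_F(E)=\{A\subseteq E: A^{\perp\perp}=A\}$, ordered by inclusion; this is a complete lattice, and it contains $\mathbb K v$ for every $v\in E$. For $i=1,2$ let $(E_i,F_i)$ be a pair of dual spaces over a division ring $\mathbb K_i$, and let $g:\mathcal L_{F_1}(E_1)\to\mathcal L_{F_2}(E_2)$ be a map that preserves arbitrary joins, sends every atom to an atom or to $0$, and whose image $g(\mathcal L_{F_1}(E_1))$, ordered by inclusion, has length at least $3$ (i.e. contains a chain of four elements $a_0<a_1<a_2<a_3$). Then $g$ is induced by a semilinear map: there are a ring homomorphism $\sigma:\mathbb K_1\to\mathbb K_2$ and an additive map $f:E_1\to E_2$ with $f(\lambda v)=\sigma(\lambda)f(v)$ for all $\lambda\in\mathbb K_1$, $v\in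 E_1$, such that $g(\mathbb K_1 v)=\mathbb K_2 f(v)$ for all $v\in E_1$. -/

import Mathlib

/-- A pair of dual spaces over a division ring `K`: a left vector space `E`, a right vector space
`F` (a module over `Kᵐᵒᵖ`), and a non-degenerate bilinear map `E × F → K`, that is, an additive map
in each variable with `form (a • x) y = a * form x y` and `form x (y • a) = form x y * a`. -/
structure DualPair (K E F : Type*) [DivisionRing K] [AddCommGroup E] [Module K E]
    [AddCommGroup F] [Module Kᵐᵒᵖ F] where
  /-- The bilinear map. -/
  form : E →ₗ[K] F →ₗ[Kᵐᵒᵖ] K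
  nondegenerate_left : ∀ x : E, (∀ y : F, form x y = 0) → x = 0
  nondegenerate_right : ∀ y : F, (∀ x : E, form x y = 0) → y = 0

namespace DualPair

section

variable {K E F : Type*} [DivisionRing K] [AddCommGroup E] [Module K E]
  [AddCommGroup F] [Module Kᵐᵒᵖ F] (P : DualPair K E F)

/-- `A^⊥ ⊆ F` for a subset `A` of `E`. -/
def rightPerp (A : Set E) : Set F := {y | ∀ x ∈ A, P.form x y = 0}

/-- `B^⊥ ⊆ E` for a subset `B` of `F`. -/
def leftPerp (B : Set F) : Set E := {x | ∀ y ∈ B, P.form x y = 0}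

/-- The lattice `L_F(E)` of all subsets `A` of `E` with `A^⊥⊥ = A`. -/
def ClosedSubspace : Type _ := {A : Set E // P.leftPerp (P.rightPerp A) = A}

/-- `L_F(E)` is ordered by set inclusion. -/
instance : PartialOrder P.ClosedSubspace :=
  inferInstanceAs (PartialOrder {A : Set E // P.leftPerp (P.rightPerp A) = A})

theorem subset_perp_perp (A : Set E) : A ⊆ P.leftPerp (P.rightPerp A) :=
  fun x hx _ hy => hy x hx

theorem perp_perp_mono {A B : Set E} (h : A ⊆ B) :
    P.leftPerp (P.rightPerp A) ⊆ P.leftPerp (P.rightPerp B) :=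
  fun _ hx y hy => hx y fun z hz => hy z (h hz)

/-- The infimum of a set of elements of `L_F(E)` is their intersection. -/
instance : InfSet P.ClosedSubspace where
  sInf S := ⟨⋂ A ∈ S, A.1, by
    refine Set.Subset.antisymm ?_ (P.subset_perp_perp _)
    refine Set.subset_iInter₂ fun A hA => ?_
    exact (P.perp_perp_mono (Set.biInter_subset_of_mem hA)).trans A.2.le⟩

/-- `L_F(E)` is a complete lattice for set inclusion. -/
noncomputable instance : CompleteLattice P.ClosedSubspace :=
  completeLatticeOfInf P.ClosedSubspace fun _ =>
    ⟨fun _ hA => Set.biInter_subset_of_mem (t := fun A : P.ClosedSubspace => A.1) hA,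
      fun _ hB => Set.subset_iInter₂ fun _ hA => hB hA⟩

/-- Every subspace `K v` of `E` is an element of `L_F(E)`. -/
theorem perp_perp_span_singleton (v : E) :
    P.leftPerp (P.rightPerp (Submodule.span K {v} : Set E)) = (Submodule.span K {v} : Set E) := by
  refine Set.Subset.antisymm (fun x hx => ?_) (P.subset_perp_perp _)
  have hx' : ∀ y : F, P.form v y = 0 → P.form x y = 0 := by
    intro y hy
    refine hx y fun z hz => ?_
    obtain ⟨a, rfl⟩ := Submodule.mem_span_singleton.1 hz
    simp [hy]
  by_cases hv : ∀ y : F, P.form v y = 0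
  · have : x = 0 := P.nondegenerate_left x fun y => hx' y (hv y)
    rw [this]
    exact Submodule.zero_mem _
  · push Not at hv
    obtain ⟨y₀, hy₀⟩ := hv
    refine Submodule.mem_span_singleton.2 ⟨P.form x y₀ * (P.form v y₀)⁻¹, ?_⟩
    refine (sub_eq_zero.1 (P.nondegenerate_left _ fun y => ?_)).symm
    have h := hx' (y - MulOpposite.op ((P.form v y₀)⁻¹ * P.form v y) • y₀) (by
      simp [mul_inv_cancel_left₀ hy₀])
    simp only [map_sub, map_smul, MulOpposite.smul_eq_mul_unop, MulOpposite.unop_op] at h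
    simpa [mul_assoc] using h

/-- The subspace `K v` as an element of `L_F(E)`. -/
def ray (v : E) : P.ClosedSubspace :=
  ⟨(Submodule.span K {v} : Set E), P.perp_perp_span_singleton v⟩

end

end DualPair

/-! Put `G v = g (P₁.ray v)`, a subspace of dimension at most one. Adding a line to a closed
subspace gives a closed subspace, so the join of two rays is their linear sum and `G` preserves
collinearity. Each element of `L_F(E)` is a join of rays, so each strict step of a chain in the
image of `g` is witnessed by a ray; three steps give three independent points in the image of `G`.

What remains is the fundamental theorem of projective geometry for possibly degenerate maps. Fix `G
u = ⟨c⟩`. If `c ∉ G v`, exactly one `x` satisfies `G v = ⟨x⟩` and `G (u + v) = ⟨c + x⟩`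
(`exists_compatible`, `eq_of_span_add_eq`). This normalised representative is additive in general
position (`compatible_add`). Using three mutually normalised base points gives a representative `f
v` for every `v` (`exists_compatible_frame`), and `f` is additive (`exists_additive_of_frame`). An
additive map that respects lines and has rank at least two is semilinear. -/

open Submodule

/-! ### From additive to semilinear maps. -/

section Semilinear

/-- An additive map sending each line into the line spanned by the image, whose image is not
contained in a line, is semilinear. -/
theorem exists_semilinear_of_additive {K₁ E₁ K₂ E₂ : Type*}
    [DivisionRing K₁] [AddCommGroup E₁] [Module K₁ E₁]
    [DivisionRing K₂] [AddCommGroup E₂] [Module K₂ E₂] (f : E₁ →+ E₂)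
    (hf : ∀ (a : K₁) (v : E₁), f (a • v) ∈ span K₂ {f v})
    (hrank : ∀ x : E₂, ∃ v, f v ∉ span K₂ {x}) :
    ∃ (σ : K₁ →+* K₂) (F : E₁ →ₛₗ[σ] E₂), ∀ v, F v = f v := by
  obtain ⟨u, hu⟩ := hrank 0
  have hu0 : f u ≠ 0 := fun h => hu (by rw [h]; exact zero_mem _)
  have hs : ∀ a : K₁, ∃ s : K₂, s • f u = f (a • u) := fun a => mem_span_singleton.1 (hf a u)
  choose s hs using hs
  -- Independent images share their scalar: compare coefficients in `f (a • (v + w)) = f (a • v) + f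
  -- (a • w)`.
  have indep : ∀ v w : E₁, f v ≠ 0 → f w ∉ span K₂ {f v} → ∀ (a : K₁) (t : K₂),
      f (a • v) = t • f v → f (a • w) = t • f w := by
    intro v w hv hw a t ht
    obtain ⟨r, hr⟩ := mem_span_singleton.1 (hf a w)
    obtain ⟨q, hq⟩ := mem_span_singleton.1 (hf a (v + w))
    rw [smul_add, map_add, map_add, ht, ← hr] at hq
    have h1 : (q - r) • f w = (t - q) • f v := by
      rw [sub_smul, sub_smul, sub_eq_sub_iff_add_eq_add, add_comm, ← smul_add, hq]
    have hqr : q - r = 0 := by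
      by_contra h
      refine hw ((smul_mem_iff _ h).1 ?_)
      rw [h1]
      exact smul_mem _ _ (mem_span_singleton_self _)
    rw [hqr, zero_smul, eq_comm, smul_eq_zero, or_iff_left hv, sub_eq_zero] at h1
    rw [← hr, h1, ← sub_eq_zero.1 hqr]
  have hsmul : ∀ (a : K₁) (v : E₁), f (a • v) = s a • f v := by
    intro a v
    by_cases hv : f v ∈ span K₂ {f u}
    · by_cases hv0 : f v = 0
      · have := hf a v
        rw [hv0, span_zero_singleton, mem_bot] at this
        rw [this, hv0, smul_zero]
      -- When `f v` is parallel to `f u`, the scalar is carried from `u` to `v` through a `w` whose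
      -- image is off their common line.
      · obtain ⟨w, hw⟩ := hrank (f u)
        have h1 := indep u w hu0 hw a (s a) (hs a).symm
        have hw0 : f w ≠ 0 := fun h => hw (by rw [h]; exact zero_mem _)
        refine indep w v hw0 (fun h => ?_) a (s a) h1
        have h2 : span K₂ {f v} = span K₂ {f u} := by
          obtain ⟨r, hr⟩ := mem_span_singleton.1 hv
          have hr0 : r ≠ 0 := by rintro rfl; exact hv0 (by rw [← hr, zero_smul])
          rw [← hr]
          exact span_singleton_smul_eq hr0.isUnit _
        obtain ⟨r, hr⟩ := mem_span_singleton.1 h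
        have hr0 : r ≠ 0 := by rintro rfl; exact hv0 (by rw [← hr, zero_smul])
        refine hw ((smul_mem_iff _ hr0).1 ?_)
        rw [hr]
        exact hv
    · exact indep u v hu0 hv a (s a) (hs a).symm
  have cancel : ∀ a b : K₂, a • f u = b • f u → a = b := fun a b h => smul_left_injective _ hu0 h
  let σ : K₁ →+* K₂ :=
    { toFun := s
      map_one' := cancel _ _ (by rw [hs, one_smul, one_smul])
      map_mul' := fun a b => cancel _ _ (by rw [hs, mul_smul, mul_smul, hsmul, hsmul])
      map_zero' := cancel _ _ (by rw [hs, zero_smul, zero_smul, map_zero])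
      map_add' := fun a b => cancel _ _ (by rw [hs, add_smul, add_smul, map_add, hs, hs]) }
  exact ⟨σ, { toFun := f, map_add' := f.map_add, map_smul' := hsmul }, fun _ => rfl⟩

end Semilinear

/-! ### Linear algebra of lines and triples. -/

section Span

variable {K E : Type*} [DivisionRing K] [AddCommGroup E] [Module K E]

/-- Uniqueness of the normalised representative: modulo `S`, the coefficient of `c` forces the
proportionality factor to be 1. -/
theorem eq_of_span_add_eq {S : Submodule K E} {c x y : E} (hc : c ∉ S) (hx : x ∈ S) (hy : y ∈ S)
    (h : span K {c + x} = span K {c + y}) : x = y := by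
  have h1 : c + x ∈ span K {c + y} := h ▸ mem_span_singleton_self _
  obtain ⟨t, ht⟩ := mem_span_singleton.1 h1
  have h2 : (t - 1) • c = x - t • y := by
    rw [sub_smul, one_smul, sub_eq_sub_iff_add_eq_add, ← smul_add, ht, add_comm]
  have h3 : t - 1 = 0 := by
    by_contra h
    refine hc ((smul_mem_iff _ h).1 ?_)
    rw [h2]
    exact sub_mem hx (smul_mem _ _ hy)
  rw [h3, zero_smul, sub_eq_zero.1 h3, one_smul] at h2
  exact (sub_eq_zero.1 h2.symm)

theorem LinearIndependent.exists_notMem_span_pair {e : Fin 3 → E} (he : LinearIndependent K e)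
    (x y : E) : ∃ i, e i ∉ span K {x, y} := by
  by_contra! h
  have h1 : span K (Set.range e) ≤ span K {x, y} := span_le.2 (Set.range_subset_iff.2 h)
  have h2 := finrank_span_eq_card he
  have : FiniteDimensional K (span K {x, y}) := FiniteDimensional.span_of_finite K (Set.toFinite _)
  have h3 := Submodule.finrank_mono h1
  have h4 : Module.finrank K (span K {x, y}) ≤ 2 := by
    classical
    have := finrank_span_finset_le_card (R := K) ({x, y} : Finset E)
    rw [Finset.coe_pair] at this
    exact this.trans Finset.card_le_two
  rw [h2, Fintype.card_fin] at h3
  omega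

theorem LinearIndependent.notMem_span_pair {e : Fin 3 → E} (he : LinearIndependent K e)
    {i j k : Fin 3} (hi : k ≠ i) (hj : k ≠ j) : e k ∉ span K {e i, e j} := by
  have := he.notMem_span_image (s := {i, j}) (x := k) (by simp [hi, hj])
  rwa [Set.image_pair] at this

theorem LinearIndependent.notMem_span_one {e : Fin 3 → E} (he : LinearIndependent K e)
    {i k : Fin 3} (hi : k ≠ i) : e k ∉ span K {e i} := by
  have := he.notMem_span_pair hi hi
  rwa [Set.pair_eq_singleton] at this

theorem linearIndependent_triple {x y z : E} (hz : z ≠ 0) (hy : y ∉ span K {z})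
    (hx : x ∉ span K {y, z}) : LinearIndependent K ![x, y, z] := by
  refine linearIndependent_finCons.2 ⟨linearIndependent_finCons.2
    ⟨LinearIndependent.of_subsingleton (0 : Fin 1) hz, ?_⟩, ?_⟩
  · simpa using hy
  · simpa [Set.pair_comm] using hx

theorem mem_span_pair_exchange {x y z : E} (h : x ∈ span K {y, z}) (hx : x ∉ span K {y}) :
    z ∈ span K {y, x} := by
  rw [Set.pair_comm] at h ⊢
  exact mem_span_insert_exchange h hx

end Span

/-! ### The fundamental theorem of projective geometry. -/

section ProjectiveMap

variable {K₁ E₁ K₂ E₂ : Type*} [DivisionRing K₁] [AddCommGroup E₁] [Module K₁ E₁]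
    [DivisionRing K₂] [AddCommGroup E₂] [Module K₂ E₂]

/-- A map from the vectors of `E₁` to subspaces of `E₂` of dimension at most one that preserves
collinearity. -/
structure IsProjectiveMap (K₁ : Type*) {E₁ K₂ E₂ : Type*} [DivisionRing K₁] [AddCommGroup E₁]
    [Module K₁ E₁] [DivisionRing K₂] [AddCommGroup E₂] [Module K₂ E₂]
    (G : E₁ → Submodule K₂ E₂) : Prop where
  exists_span : ∀ v, ∃ x, G v = span K₂ {x}
  le_sup : ∀ u w v, v ∈ span K₁ {u, w} → G v ≤ G u ⊔ G w

/-- The vector `x` represents `G v`, and `c + x` represents `G (u + v)`. -/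
def Compatible (G : E₁ → Submodule K₂ E₂) (u : E₁) (c : E₂) (v : E₁) (x : E₂) : Prop :=
  G v = span K₂ {x} ∧ G (u + v) = span K₂ {c + x}

theorem Compatible.symm {G : E₁ → Submodule K₂ E₂} {u v : E₁} {c x : E₂}
    (h : Compatible G u c v x) (hu : G u = span K₂ {c}) : Compatible G v x u c :=
  ⟨hu, by rw [add_comm, h.2, add_comm]⟩

namespace IsProjectiveMap

variable {G : E₁ → Submodule K₂ E₂} (hG : IsProjectiveMap K₁ G)

include hG

theorem add_le (u v : E₁) : G (u + v) ≤ G u ⊔ G v :=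
  hG.le_sup _ _ _ (mem_span_pair.2 ⟨1, 1, by simp⟩)

theorem le_add (u v : E₁) : G u ≤ G (u + v) ⊔ G v :=
  hG.le_sup _ _ _ (mem_span_pair.2 ⟨1, -1, by simp⟩)

theorem add_eq_of_eq_bot (u : E₁) {n : E₁} (hn : G n = ⊥) : G (u + n) = G u :=
  le_antisymm (by simpa [hn] using hG.add_le u n) (by simpa [hn] using hG.le_add u n)

theorem smul_le (a : K₁) (v : E₁) : G (a • v) ≤ G v := by
  have h : v ∈ span K₁ {v, v} := subset_span (Set.mem_insert _ _)
  simpa using hG.le_sup v v (a • v) (smul_mem _ a h)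

/-- A generator of `G (u + v)` has the form `α • c + β • y` with `G v = ⟨y⟩`. Here `α ≠ 0`, since
otherwise `c` would lie in `G v`; dividing by `α` normalises it. -/
theorem exists_compatible {u v : E₁} {c : E₂} (hu : G u = span K₂ {c}) (hc : c ∉ G v) :
    ∃ x, Compatible G u c v x := by
  obtain ⟨y, hy⟩ := hG.exists_span v
  obtain ⟨z, hz⟩ := hG.exists_span (u + v)
  have h1 := hG.add_le u v
  have h2 := hG.le_add u v
  have h3 := hG.le_add v u
  rw [add_comm v u] at h3
  rw [hu, hy, hz, ← span_union, Set.singleton_union, span_singleton_le_iff_mem] at h1 h2 h3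
  rw [hy] at hc
  obtain ⟨α, β, hab⟩ := mem_span_pair.1 h1
  have hα : α ≠ 0 := by
    rintro rfl
    refine hc (span_le.2 ?_ h2)
    rintro _ (rfl | rfl)
    · rw [← hab, zero_smul, zero_add]
      exact smul_mem _ _ (mem_span_singleton_self _)
    · exact mem_span_singleton_self _
  refine ⟨(α⁻¹ * β) • y, ?_, ?_⟩
  · rw [hy]
    by_cases hβ : β = 0
    · subst hβ
      rw [zero_smul, add_zero] at hab
      have : y ∈ span K₂ {c} := by
        refine span_le.2 ?_ h3
        rintro _ (rfl | rfl)
        · rw [← hab]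
          exact smul_mem _ _ (mem_span_singleton_self _)
        · exact mem_span_singleton_self _
      obtain ⟨t, ht⟩ := mem_span_singleton.1 this
      have ht0 : t = 0 := by
        by_contra h
        refine hc ((smul_mem_iff _ h).1 ?_)
        rw [ht]
        exact mem_span_singleton_self _
      rw [← ht, ht0]
      simp
    · exact (span_singleton_smul_eq (mul_ne_zero (inv_ne_zero hα) hβ).isUnit _).symm
  · rw [hz, ← hab, ← span_singleton_smul_eq (inv_ne_zero hα).isUnit, smul_add, smul_smul,
      smul_smul, inv_mul_cancel₀ hα, one_smul]

/-- When `x ≠ 0`, `G (u + v + w)` lies in both `⟨c + x, y⟩` and `⟨c + y, x⟩`, which meet only in `⟨c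
+ x + y⟩`. Uniqueness then identifies the representative of `v + w`. When `x = 0`, adding `v` does
not change `G`. -/
theorem compatible_add {u v w : E₁} {c x y : E₂} (hu : G u = span K₂ {c})
    (hv : Compatible G u c v x) (hw : Compatible G u c w y) (hc : c ∉ span K₂ {x, y})
    (hxy : x = 0 ∨ y ∉ span K₂ {x}) : G (v + w) = span K₂ {x + y} ∧
      G (u + (v + w)) = span K₂ {c + (x + y)} := by
  by_cases hx : x = 0
  · subst hx
    have hv0 : G v = ⊥ := by rw [hv.1, span_zero_singleton]
    rw [add_comm v w, ← add_assoc, hG.add_eq_of_eq_bot _ hv0, hG.add_eq_of_eq_bot _ hv0, zero_add]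
    exact hw
  have hyx := hxy.resolve_left hx
  have hxm : x ∈ span K₂ {x, y} := subset_span (by simp)
  have hym : y ∈ span K₂ {x, y} := subset_span (by simp)
  have hsum : G (v + w) ≤ span K₂ {x, y} := by
    have := hG.add_le v w
    rwa [hv.1, hw.1, ← span_union, Set.singleton_union] at this
  obtain ⟨z, hz⟩ := hG.exists_span (u + (v + w))
  have h1 := hG.add_le (u + v) w
  have h2 := hG.add_le (u + w) v
  rw [add_assoc] at h1 h2
  rw [add_comm w v] at h2
  rw [hz, hv.2, hw.1, ← span_union, Set.singleton_union, span_singleton_le_iff_mem] at h1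
  rw [hz, hw.2, hv.1, ← span_union, Set.singleton_union, span_singleton_le_iff_mem] at h2
  obtain ⟨α, β, h1⟩ := mem_span_pair.1 h1
  obtain ⟨γ, δ, h2⟩ := mem_span_pair.1 h2
  have e1 : (α - γ) • c = (δ - α) • x + (γ - β) • y := by
    have h := h1.trans h2.symm
    simp only [smul_add] at h
    simp only [sub_smul]
    rw [← sub_eq_zero] at h ⊢
    rw [← h]
    abel
  have hαγ : α - γ = 0 := by
    by_contra h
    refine hc ((smul_mem_iff _ h).1 ?_)
    rw [e1]
    exact add_mem (smul_mem _ _ hxm) (smul_mem _ _ hym)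
  rw [hαγ, zero_smul] at e1
  have hγβ : γ - β = 0 := by
    by_contra h
    refine hyx ((smul_mem_iff _ h).1 ?_)
    rw [← neg_eq_of_add_eq_zero_right e1.symm]
    exact neg_mem (smul_mem _ _ (mem_span_singleton_self _))
  have hαβ : α = β := (sub_eq_zero.1 hαγ).trans (sub_eq_zero.1 hγβ)
  subst hαβ
  rw [← smul_add, add_assoc] at h1
  have hα : α ≠ 0 := by
    rintro rfl
    rw [zero_smul] at h1
    have := hG.le_add u (v + w)
    rw [hz, ← h1, span_zero_singleton, bot_sup_eq, hu, span_singleton_le_iff_mem] at this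
    exact hc (hsum this)
  have hz' : G (u + (v + w)) = span K₂ {c + (x + y)} := by
    rw [hz, ← h1, span_singleton_smul_eq hα.isUnit]
  obtain ⟨t, ht⟩ := hG.exists_compatible hu (fun h => hc (hsum h))
  have htm : t ∈ span K₂ {x, y} := hsum (ht.1 ▸ mem_span_singleton_self t)
  have : t = x + y := eq_of_span_add_eq hc htm (add_mem hxm hym) (ht.2.symm.trans hz')
  exact ⟨this ▸ ht.1, hz'⟩

/-- Changes the base point from `e₁` to `e₂`, keeping the representative of `v`. -/
theorem compatible_transfer {e₁ e₂ v : E₁} {ε₁ ε₂ x : E₂} (h₁ : G e₁ = span K₂ {ε₁})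
    (h : Compatible G e₁ ε₁ e₂ ε₂)
    (hv : Compatible G e₁ ε₁ v x) (hx₁ : ε₁ ∉ span K₂ {x, ε₂}) (hx₂ : ε₂ ∉ span K₂ {x}) :
    Compatible G e₂ ε₂ v x :=
  ⟨hv.1, by
    have := (hG.compatible_add h₁ hv h hx₁ (Or.inr hx₂)).1
    rwa [add_comm, add_comm x] at this⟩

theorem exists_compatible_frame {e : Fin 3 → E₁} {ε : Fin 3 → E₂} (hε : LinearIndependent K₂ ε)
    (he : ∀ i, G (e i) = span K₂ {ε i})
    (hcomp : ∀ i j, i ≠ j → Compatible G (e i) (ε i) (e j) (ε j)) (v : E₁) :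
    ∃ x, ∀ i, ε i ∉ G v → Compatible G (e i) (ε i) v x := by
  have hex : ∃ i, ε i ∉ G v := by
    obtain ⟨y, hy⟩ := hG.exists_span v
    obtain ⟨i, hi⟩ := hε.exists_notMem_span_pair y y
    rw [Set.pair_eq_singleton, ← hy] at hi
    exact ⟨i, hi⟩
  obtain ⟨i, hi⟩ := hex
  obtain ⟨x, hx⟩ := hG.exists_compatible (he i) hi
  refine ⟨x, fun j hj => ?_⟩
  rcases eq_or_ne i j with rfl | hij
  · exact hx
  rw [hx.1] at hi hj
  by_cases hd : ε i ∈ span K₂ {x, ε j}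
  -- Here `x` lies in the plane of `ε i` and `ε j`, so a direct transfer is not available; the third
  -- base point is outside that plane and serves as an intermediate stop.
  · obtain ⟨k, hki, hkj⟩ : ∃ k, k ≠ i ∧ k ≠ j := by
      exact (by decide : ∀ i j : Fin 3, ∃ k, k ≠ i ∧ k ≠ j) i j
    have hxs : x ∈ span K₂ {ε j, ε i} := by
      rw [Set.pair_comm] at hd
      exact mem_span_pair_exchange hd (hε.notMem_span_one hij)
    have hk : ε k ∉ span K₂ {ε j, ε i} := hε.notMem_span_pair hkj hki
    have hle : ∀ l, ε l ∈ span K₂ {ε j, ε i} → span K₂ {x, ε l} ≤ span K₂ {ε j, ε i} := by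
      intro l hl
      refine span_le.2 ?_
      rintro _ (rfl | rfl)
      · exact hxs
      · exact hl
    have hik : ε i ∉ span K₂ {x, ε k} := fun h =>
      hk (hle i (subset_span (by simp)) (mem_span_pair_exchange h hi))
    have hkx : ε k ∉ span K₂ {x} := fun h => hk ((span_singleton_le_iff_mem _ _).2 hxs h)
    have hck := hG.compatible_transfer (he i) (hcomp i k hki.symm) hx hik hkx
    exact hG.compatible_transfer (he k) (hcomp k j hkj) hck
      (fun h => hk (hle j (subset_span (by simp)) h)) hj
  · exact hG.compatible_transfer (he i) (hcomp i j hij) hx hd hj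

theorem exists_additive_of_frame {e : Fin 3 → E₁} {ε : Fin 3 → E₂} (hε : LinearIndependent K₂ ε)
    (he : ∀ i, G (e i) = span K₂ {ε i})
    (hcomp : ∀ i j, i ≠ j → Compatible G (e i) (ε i) (e j) (ε j)) :
    ∃ f : E₁ →+ E₂, ∀ v, G v = span K₂ {f v} := by
  choose f hf using hG.exists_compatible_frame hε he hcomp
  have hspan : ∀ v, G v = span K₂ {f v} := by
    intro v
    obtain ⟨y, hy⟩ := hG.exists_span v
    obtain ⟨i, hi⟩ := hε.exists_notMem_span_pair y y
    rw [Set.pair_eq_singleton, ← hy] at hi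
    exact (hf v i hi).1
  have key : ∀ v w, (f v = 0 ∨ f w ∉ span K₂ {f v}) → f (v + w) = f v + f w := by
    intro v w h
    obtain ⟨i, hi⟩ := hε.exists_notMem_span_pair (f v) (f w)
    have hle : G v ⊔ G w = span K₂ {f v, f w} := by
      rw [hspan, hspan, ← span_union, Set.singleton_union]
    have hvi : ε i ∉ G v := fun h => hi (hle ▸ mem_sup_left h)
    have hwi : ε i ∉ G w := fun h => hi (hle ▸ mem_sup_right h)
    have hvw : ε i ∉ G (v + w) := fun h => hi (hle ▸ hG.add_le v w h)
    obtain ⟨h1, h2⟩ := hG.compatible_add (he i) (hf v i hvi) (hf w i hwi) hi h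
    have h3 := hf (v + w) i hvw
    refine eq_of_span_add_eq hvw ?_ ?_ (h3.2.symm.trans h2)
    · rw [h3.1]; exact mem_span_singleton_self _
    · rw [h1]; exact mem_span_singleton_self _
  have hadd : ∀ v w, f (v + w) = f v + f w := by
    intro v w
    by_cases hw0 : f w = 0
    · rw [add_comm, key w v (Or.inl hw0), add_comm]
    by_cases hvw : f v = 0 ∨ f w ∉ span K₂ {f v}
    · exact key v w hvw
    push Not at hvw
    -- For parallel nonzero images, take `e i` with image off their line and expand `f (v + w + e
    -- i)` in two ways.
    obtain ⟨i, hi⟩ := hε.exists_notMem_span_pair (f v) (f v)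
    rw [Set.pair_eq_singleton] at hi
    have hei : f (e i) ∉ span K₂ {f v} := by
      intro h
      rw [← span_singleton_le_iff_mem, ← hspan, he, span_singleton_le_iff_mem] at h
      exact hi h
    have hwle : span K₂ {f w} ≤ span K₂ {f v} := (span_singleton_le_iff_mem _ _).2 hvw.2
    have hsum : span K₂ {f (v + w)} ≤ span K₂ {f v} := by
      rw [← hspan, ← hspan v]
      exact (hG.add_le v w).trans (sup_le le_rfl (by rwa [hspan w, hspan v]))
    have h1 := key w (e i) (Or.inr fun h => hei (hwle h))
    have h2 := key v (w + e i) (Or.inr fun h => hei (by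
      rw [h1] at h
      simpa using sub_mem h hvw.2))
    have h3 := key (v + w) (e i) (Or.inr fun h => hei (hsum h))
    rw [add_assoc, h2, h1, ← add_assoc] at h3
    exact (add_right_cancel h3).symm
  exact ⟨AddMonoidHom.mk' f hadd, hspan⟩

/-- The fundamental theorem of projective geometry: a projective map whose image contains three
independent points is induced by a semilinear map. -/
theorem exists_semilinear {e : Fin 3 → E₁} {ε : Fin 3 → E₂} (hε : LinearIndependent K₂ ε)
    (he : ∀ i, G (e i) = span K₂ {ε i}) :
    ∃ (σ : K₁ →+* K₂) (f : E₁ →ₛₗ[σ] E₂), ∀ v, G v = span K₂ {f v} := by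
  have h01 : ε 0 ∉ G (e 1) := by rw [he]; exact hε.notMem_span_one (by decide)
  have h02 : ε 0 ∉ G (e 2) := by rw [he]; exact hε.notMem_span_one (by decide)
  -- The representatives `ε 1` and `ε 2` are rescaled to be compatible with `ε 0`; `compatible_add`
  -- then makes them compatible with each other.
  obtain ⟨x, hx⟩ := hG.exists_compatible (he 0) h01
  obtain ⟨y, hy⟩ := hG.exists_compatible (he 0) h02
  have hx1 : span K₂ {x} = span K₂ {ε 1} := by rw [← hx.1, he]
  have hy1 : span K₂ {y} = span K₂ {ε 2} := by rw [← hy.1, he]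
  have hc : ε 0 ∉ span K₂ {x, y} := by
    rw [span_insert, hx1, hy1, ← span_insert]
    exact hε.notMem_span_pair (by decide) (by decide)
  have hyx : y ∉ span K₂ {x} := by
    rw [← span_singleton_le_iff_mem, hy1, hx1, span_singleton_le_iff_mem]
    exact hε.notMem_span_one (by decide)
  have hxy := hG.compatible_add (he 0) hx hy hc (Or.inr hyx)
  have hxyc : Compatible G (e 1) x (e 2) y := ⟨hy.1, hxy.1⟩
  have hε' : LinearIndependent K₂ ![ε 0, x, y] := by
    refine linearIndependent_triple ?_ ?_ hc
    · rintro rfl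
      exact hyx (zero_mem _)
    · rw [← span_singleton_le_iff_mem, hy1, hx1, span_singleton_le_iff_mem]
      exact hε.notMem_span_one (by decide)
  have he' : ∀ i, G (e i) = span K₂ {(![ε 0, x, y] : Fin 3 → E₂) i} := by
    intro i
    fin_cases i
    · exact he 0
    · exact hx.1
    · exact hy.1
  obtain ⟨f, hf⟩ := hG.exists_additive_of_frame hε' he' (by
    intro i j hij
    fin_cases i <;> fin_cases j
    · exact absurd rfl hij
    · exact hx
    · exact hy
    · exact hx.symm (he 0)
    · exact absurd rfl hij
    · exact hxyc
    · exact hy.symm (he 0)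
    · exact hxyc.symm hx.1
    · exact absurd rfl hij)
  obtain ⟨σ, F, hF⟩ := exists_semilinear_of_additive f (fun a v => by
    rw [← hf]
    refine hG.smul_le a v ?_
    rw [hf]
    exact mem_span_singleton_self _) (fun z => by
    obtain ⟨i, hi⟩ := hε.exists_notMem_span_pair z z
    rw [Set.pair_eq_singleton] at hi
    refine ⟨e i, fun h => hi ?_⟩
    rw [← span_singleton_le_iff_mem, ← hf, he, span_singleton_le_iff_mem] at h
    exact h)
  exact ⟨σ, F, fun v => by rw [hF, hf]⟩

end IsProjectiveMap

end ProjectiveMap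

/-! ### Closed subspaces, rays and their joins. -/

namespace DualPair

variable {K E F : Type*} [DivisionRing K] [AddCommGroup E] [Module K E]
  [AddCommGroup F] [Module Kᵐᵒᵖ F] (P : DualPair K E F)

/-- A closed subspace, as a submodule. -/
def ClosedSubspace.toSubmodule {P : DualPair K E F} (A : P.ClosedSubspace) : Submodule K E where
  carrier := A.1
  zero_mem' := by rw [← A.2]; intro y _; simp
  add_mem' := by
    rw [← A.2]
    intro x z hx hz y hy
    rw [map_add, LinearMap.add_apply, hx y hy, hz y hy, add_zero]
  smul_mem' := by
    rw [← A.2]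
    intro a x hx y hy
    rw [map_smul, LinearMap.smul_apply, hx y hy, smul_zero]

theorem ClosedSubspace.toSubmodule_le {P : DualPair K E F} {A B : P.ClosedSubspace} :
    A.toSubmodule ≤ B.toSubmodule ↔ A ≤ B := Iff.rfl

theorem ClosedSubspace.toSubmodule_injective {P : DualPair K E F} :
    Function.Injective (ClosedSubspace.toSubmodule (P := P)) := fun _ _ h =>
  le_antisymm (toSubmodule_le.1 h.le) (toSubmodule_le.1 h.ge)

theorem toSubmodule_ray (v : E) : (P.ray v).toSubmodule = span K {v} := rfl

theorem ray_le {v : E} {A : P.ClosedSubspace} : P.ray v ≤ A ↔ v ∈ A.toSubmodule := by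
  rw [← ClosedSubspace.toSubmodule_le, toSubmodule_ray, span_singleton_le_iff_mem]

theorem ray_zero : P.ray 0 = ⊥ := le_bot_iff.1 (P.ray_le.2 (zero_mem _))

theorem toSubmodule_bot : (⊥ : P.ClosedSubspace).toSubmodule = ⊥ := by
  rw [← P.ray_zero, toSubmodule_ray, span_zero_singleton]

theorem exists_ray_eq {A : P.ClosedSubspace} (h : IsAtom A ∨ A = ⊥) : ∃ x, A = P.ray x := by
  rcases h with h | rfl
  · have hne : A.toSubmodule ≠ ⊥ := fun h' =>
      h.1 (ClosedSubspace.toSubmodule_injective (h'.trans P.toSubmodule_bot.symm))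
    obtain ⟨x, hx, hx0⟩ := Submodule.exists_mem_ne_zero_of_ne_bot hne
    refine ⟨x, ((h.le_iff.1 (P.ray_le.2 hx)).resolve_left fun h' => hx0 ?_).symm⟩
    have := P.ray_le.1 h'.le
    rwa [toSubmodule_bot, mem_bot] at this
  · exact ⟨0, P.ray_zero.symm⟩

theorem isAtom_ray {v : E} (hv : v ≠ 0) : IsAtom (P.ray v) := by
  constructor
  · intro h
    have := P.ray_le.1 h.le
    rw [toSubmodule_bot, mem_bot] at this
    exact hv this
  · intro B hB
    by_contra hne
    have hne : B.toSubmodule ≠ ⊥ := fun h' =>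
      hne (ClosedSubspace.toSubmodule_injective (h'.trans P.toSubmodule_bot.symm))
    obtain ⟨x, hx, hx0⟩ := Submodule.exists_mem_ne_zero_of_ne_bot hne
    have h1 : x ∈ span K {v} := ClosedSubspace.toSubmodule_le.2 hB.le hx
    obtain ⟨a, rfl⟩ := mem_span_singleton.1 h1
    have ha : a ≠ 0 := by rintro rfl; exact hx0 (zero_smul _ _)
    exact hB.not_ge (P.ray_le.2 ((smul_mem_iff _ ha).1 hx))

/-- The sum of a closed subspace and a line is closed. -/
theorem perp_perp_sup_span_singleton (A : P.ClosedSubspace) (v : E) :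
    P.leftPerp (P.rightPerp (A.toSubmodule ⊔ span K {v} : Submodule K E)) =
      (A.toSubmodule ⊔ span K {v} : Submodule K E) := by
  refine Set.Subset.antisymm (fun x hx => ?_) (P.subset_perp_perp _)
  have hx' : ∀ y ∈ P.rightPerp A.1, P.form v y = 0 → P.form x y = 0 := by
    intro y hyA hy
    refine hx y fun z hz => ?_
    obtain ⟨b, hb, c, hc, rfl⟩ := mem_sup.1 hz
    obtain ⟨a, rfl⟩ := mem_span_singleton.1 hc
    have : P.form b y = 0 := hyA b hb
    simp [hy, this]
  have memA : ∀ z, (∀ y ∈ P.rightPerp A.1, P.form z y = 0) → z ∈ A.toSubmodule := by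
    intro z hz
    change z ∈ A.1
    rw [← A.2]
    exact hz
  by_cases hv : ∀ y ∈ P.rightPerp A.1, P.form v y = 0
  · exact mem_sup_left (memA x fun y hy => hx' y hy (hv y hy))
  · push Not at hv
    obtain ⟨y₀, hyA₀, hy₀⟩ := hv
    -- The coefficient makes the difference orthogonal to `y₀`. Any `y` in `A^⊥`, corrected by a
    -- multiple of `y₀`, becomes orthogonal to `v`, hence to `x`; so the difference lies in `A^⊥⊥ =
    -- A`.
    refine mem_sup.2 ⟨x - (P.form x y₀ * (P.form v y₀)⁻¹) • v, memA _ fun y hy => ?_, _,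
      smul_mem _ (P.form x y₀ * (P.form v y₀)⁻¹) (mem_span_singleton_self v), sub_add_cancel _ _⟩
    have h := hx' (y - MulOpposite.op ((P.form v y₀)⁻¹ * P.form v y) • y₀) (by
      intro b hb
      have h1 : P.form b y = 0 := hy b hb
      have h2 : P.form b y₀ = 0 := hyA₀ b hb
      simp [h1, h2]) (by
      simp [mul_inv_cancel_left₀ hy₀])
    simp only [map_sub, map_smul, MulOpposite.smul_eq_mul_unop, MulOpposite.unop_op] at h
    simpa [mul_assoc] using h

/-- A lattice join is in general only the closure of the sum; here the sum is already closed. -/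
theorem toSubmodule_ray_sup_ray (x y : E) :
    (P.ray x ⊔ P.ray y).toSubmodule = span K {x} ⊔ span K {y} := by
  refine le_antisymm ?_ (sup_le
    (ClosedSubspace.toSubmodule_le.2 (le_sup_left : P.ray x ≤ P.ray x ⊔ P.ray y))
    (ClosedSubspace.toSubmodule_le.2 (le_sup_right : P.ray y ≤ P.ray x ⊔ P.ray y)))
  let B : P.ClosedSubspace := ⟨_, P.perp_perp_sup_span_singleton (P.ray x) y⟩
  exact ClosedSubspace.toSubmodule_le.2 (sup_le (c := B) (le_sup_left (a := span K {x}))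
    (le_sup_right (b := span K {y})))

theorem eq_sSup_rays (A : P.ClosedSubspace) : A = sSup (P.ray '' A.1) := by
  refine le_antisymm (fun x hx => ?_) (sSup_le ?_)
  · exact P.ray_le.1 (le_sSup (Set.mem_image_of_mem _ hx))
  · rintro _ ⟨x, hx, rfl⟩
    exact P.ray_le.2 hx

end DualPair

/-! ### Reduction of the lattice statement to the fundamental theorem. -/

theorem corollary8p3
    {K₁ E₁ F₁ K₂ E₂ F₂ : Type*}
    [DivisionRing K₁] [AddCommGroup E₁] [Module K₁ E₁] [AddCommGroup F₁] [Module K₁ᵐᵒᵖ F₁]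
    [DivisionRing K₂] [AddCommGroup E₂] [Module K₂ E₂] [AddCommGroup F₂] [Module K₂ᵐᵒᵖ F₂]
    (P₁ : DualPair K₁ E₁ F₁) (P₂ : DualPair K₂ E₂ F₂)
    (g : P₁.ClosedSubspace → P₂.ClosedSubspace)
    (hjoin : ∀ S : Set P₁.ClosedSubspace, g (sSup S) = sSup (g '' S))
    (hatom : ∀ a : P₁.ClosedSubspace, IsAtom a → IsAtom (g a) ∨ g a = ⊥)
    (hlength : 3 ≤ Order.krullDim (Set.range g)) :
    ∃ (σ : K₁ →+* K₂) (f : E₁ →ₛₗ[σ] E₂), ∀ v : E₁, g (P₁.ray v) = P₂.ray (f v) := by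
  have hmono : Monotone g := by
    intro A B h
    have := hjoin {A, B}
    rw [Set.image_pair, sSup_pair, sSup_pair, sup_eq_right.2 h] at this
    exact this ▸ le_sup_left
  have hsup : ∀ A B, g (A ⊔ B) = g A ⊔ g B := by
    intro A B
    have := hjoin {A, B}
    rwa [Set.image_pair, sSup_pair, sSup_pair] at this
  have hbot : g ⊥ = ⊥ := by simpa using hjoin ∅
  have hray : ∀ v, ∃ x, g (P₁.ray v) = P₂.ray x := by
    intro v
    refine P₂.exists_ray_eq ?_
    by_cases hv : v = 0
    · right
      rw [hv, P₁.ray_zero, hbot]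
    · exact hatom _ (P₁.isAtom_ray hv)
  have hG : IsProjectiveMap K₁ fun v => (g (P₁.ray v)).toSubmodule := by
    refine ⟨fun v => (hray v).imp fun x hx => by rw [hx, P₂.toSubmodule_ray], fun u w v hv => ?_⟩
    obtain ⟨x, hx⟩ := hray u
    obtain ⟨y, hy⟩ := hray w
    have h1 : P₁.ray v ≤ P₁.ray u ⊔ P₁.ray w := by
      rw [P₁.ray_le, P₁.toSubmodule_ray_sup_ray, ← span_union, Set.singleton_union]
      exact hv
    have h2 := DualPair.ClosedSubspace.toSubmodule_le.2 ((hmono h1).trans_eq (hsup _ _))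
    rw [hx, hy, P₂.toSubmodule_ray_sup_ray] at h2
    simpa only [hx, hy, P₂.toSubmodule_ray] using h2
  -- If every ray under `B` had its image below `a`, then `g B`, the join of these images, would be
  -- below `a`.
  have hstep : ∀ a b : Set.range g, a < b →
      ∃ v x, g (P₁.ray v) = P₂.ray x ∧ x ∈ b.1.toSubmodule ∧ x ∉ a.1.toSubmodule := by
    rintro ⟨a, ha⟩ ⟨_, B, rfl⟩ hab
    have hlt : a < g B := hab
    by_contra! hcon
    refine hlt.not_ge ?_
    rw [P₁.eq_sSup_rays B, hjoin]
    refine sSup_le ?_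
    rintro _ ⟨_, ⟨v, hv, rfl⟩, rfl⟩
    obtain ⟨x, hx⟩ := hray v
    rw [hx]
    refine P₂.ray_le.2 (hcon v x hx ?_)
    rw [← P₂.ray_le, ← hx]
    exact hmono (P₁.ray_le.2 hv)
  obtain ⟨c, hc⟩ := (Order.le_krullDim_iff (n := 3)).1 hlength
  have hlt : ∀ i j : ℕ, ∀ (hi : i < c.length + 1) (hj : j < c.length + 1), i < j →
      c ⟨i, hi⟩ < c ⟨j, hj⟩ := fun i j hi hj h => c.strictMono (by simpa using h)
  obtain ⟨v₁, x₁, hx₁, hm₁, hn₁⟩ := hstep _ _ (hlt 0 1 (by omega) (by omega) (by omega))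
  obtain ⟨v₂, x₂, hx₂, hm₂, hn₂⟩ := hstep _ _ (hlt 1 2 (by omega) (by omega) (by omega))
  obtain ⟨v₃, x₃, hx₃, hm₃, hn₃⟩ := hstep _ _ (hlt 2 3 (by omega) (by omega) (by omega))
  have h12 : (c ⟨1, by omega⟩).1.toSubmodule ≤ (c ⟨2, by omega⟩).1.toSubmodule :=
    DualPair.ClosedSubspace.toSubmodule_le.2 (hlt 1 2 (by omega) (by omega) (by omega)).le
  -- Each point lies outside a member of the chain that contains all the earlier points; the order
  -- is reversed because `linearIndependent_triple` adjoins new vectors at the front.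
  have hind : LinearIndependent K₂ ![x₃, x₂, x₁] := by
    refine linearIndependent_triple (fun h => hn₁ (h ▸ zero_mem _)) (fun h => hn₂ ?_)
      (fun h => hn₃ (span_le.2 ?_ h))
    · exact (span_singleton_le_iff_mem _ _).2 hm₁ h
    · rintro _ (rfl | rfl)
      · exact hm₂
      · exact h12 hm₁
  obtain ⟨σ, f, hf⟩ := hG.exists_semilinear (e := ![v₃, v₂, v₁]) hind (by
    intro i
    fin_cases i
    · exact congrArg _ hx₃
    · exact congrArg _ hx₂
    · exact congrArg _ hx₁)
  exact ⟨σ, f, fun v => DualPair.ClosedSubspace.toSubmodule_injective (hf v)⟩
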